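/- Agents $n=1,2,\dots$ move in sequence. The state $\theta\in\{0,1\}$ has equal prior probabilities. Given $\theta$, the private signals $s_n\in(-1,1)$ are i.i.d. with density $f_\theta$, where $f_0,f_1$ are continuous and positive on $(-1,1)$, $f_1/f_0$ is strictly increasing, and $f_1(s)=f_0(-s)$. After seeing $s_n$, agent $n$ chooses a neighborhood $B(n)\subset\{1,\dots,n-1\}$ with $|B(n)|\le K(n)$, at cost $c\in[0,\tfrac12)$ if $B(n)\ne\varnothing$ and at no cost otherwise; here $K(n)\in\mathbb N$ and $K(n)>0$ for all but finitely many $n$. She then observes the actions of the agents in $B(n)$ and takes an action $a_n\in\{0,1\}$, with payoff $1$ if $a_n=\theta$ and $0$ otherwise, less the cost. A (measurable, pure) strategy of agent $n$ is a pair $\sigma_n=(\sigma_n^1,\sigma_n^2)$, where $\sigma_n^1$ maps the signal $s_n$ to a neighborhood, and $\sigma_n^2$ maps every information set (the signal, a feasible neighborhood, and a sequence of actions observed in it) to an action. An equilibrium is a pure strategy perfect Bayesian equilibrium $\sigma^*$ (at every information set $\sigma_n^{*2}$ maximizes the expected payoff, with beliefs given by Bayes' rule wherever the observed actions have positive probability;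 and for every signal $\sigma_n^{*1}(s_n)$ maximizes the expected payoff given $\sigma_n^{*2}$) that is symmetric, i.e. $\sigma_n^{*1}(s)=\sigma_n^{*1}(-s)$ for all $n$ and all $s\in[0,1)$. Let $\mathcal Q_{\sigma^*}$ be the law of the network $(B(n))_{n\ge1}$ generated by $\sigma^*$. Suppose that $c=0$ and that private beliefs are unbounded, i.e. $\frac{f_1(s)}{f_0(s)+f_1(s)}$ tends to $1$ as $s\to1$ and to $0$ as $s\to-1$. Then every equilibrium $\sigma^*$ has expanding observations: $$\lim_{n\to\infty}\mathcal Q_{\sigma^*}\Big(\max_{b\in B(n)}b<M\Big)=0\quad\text{for every }M\in\mathbb N,$$ where the maximum over the empty neighborhood is $-\infty$, so that the event includes $B(n)=\varnothing$. -/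

import Mathlib

open MeasureTheory Set Filter
open scoped Topology

noncomputable section

namespace SocialLearning

/-- The set `S = (-1, 1)` of possible private signals. -/
abbrev Signal : Type := Set.Ioo (-1 : ℝ) 1

instance : Neg Signal :=
  ⟨fun s => ⟨-(s : ℝ), by constructor <;> linarith [s.2.1, s.2.2]⟩⟩

/-- A signal structure. States of the world and actions are elements of `Bool`, with `true`
standing for `1` and `false` for `0`; `f θ` is the density of a private signal in state `θ`. -/
structure SignalStructure where
  f : Bool → ℝ → ℝ
  continuousOn : ∀ θ, ContinuousOn (f θ) (Ioo (-1) 1)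
  pos : ∀ θ, ∀ s ∈ Ioo (-1 : ℝ) 1, 0 < f θ s
  integral_eq_one : ∀ θ, ∫ s in Ioo (-1 : ℝ) 1, f θ s = 1
  /-- Monotone likelihood ratio property. -/
  mlrp : StrictMonoOn (fun s => f true s / f false s) (Ioo (-1) 1)
  symm : ∀ s ∈ Ioo (-1 : ℝ) 1, f true s = f false (-s)

namespace SignalStructure

variable (F : SignalStructure)

/-- The distribution of one private signal in state `θ`. -/
def signalLaw (θ : Bool) : Measure Signal :=
  ((volume : Measure ℝ).comap Subtype.val).withDensity fun s : Signal => ENNReal.ofReal (F.f θ s)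

instance (θ : Bool) : IsProbabilityMeasure (F.signalLaw θ) := by
  constructor
  have hint : IntegrableOn (F.f θ) (Ioo (-1 : ℝ) 1) := by
    by_contra h
    have h1 := F.integral_eq_one θ
    rw [integral_undef h] at h1
    exact zero_ne_one h1
  have h2 : ∫⁻ s in Ioo (-1 : ℝ) 1, ENNReal.ofReal (F.f θ s) = 1 := by
    rw [← ofReal_integral_eq_lintegral_ofReal hint, F.integral_eq_one θ, ENNReal.ofReal_one]
    exact (ae_restrict_iff' measurableSet_Ioo).2 (ae_of_all _ fun s hs => (F.pos θ s hs).le)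
  rw [signalLaw, withDensity_apply _ MeasurableSet.univ, Measure.restrict_univ, ← h2]
  exact lintegral_subtype_comap measurableSet_Ioo fun s => ENNReal.ofReal (F.f θ s)

/-- The joint law of all private signals in state `θ`: they are i.i.d. given the state. -/
def signalsLaw (θ : Bool) : Measure (ℕ → Signal) :=
  Measure.infinitePi fun _ : ℕ => F.signalLaw θ

/-- The joint law of the state and of all private signals; both states have probability `1/2`. -/
def prior : Measure (Bool × (ℕ → Signal)) :=
  (2⁻¹ : ENNReal) • ∑ θ : Bool, (Measure.dirac θ).prod (F.signalsLaw θ)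

/-- The conditional probability of state `θ` given one private signal `s`. -/
def privateBelief (θ : Bool) (s : ℝ) : ℝ :=
  F.f θ s / (F.f false s + F.f true s)

def UnboundedPrivateBeliefs : Prop :=
  Tendsto (F.privateBelief true) (𝓝[<] 1) (𝓝 1) ∧
    Tendsto (F.privateBelief true) (𝓝[>] (-1)) (𝓝 0)

end SignalStructure

/-- The sequential observation model. The agents are numbered `0, 1, 2, …` in the order in which
they move, so that the predecessors of agent `n` are the elements of `Finset.range n`. -/
structure Model extends SignalStructure where
  /-- The cost of observation. -/
  c : ℝ
  c_nonneg : 0 ≤ c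
  c_lt_half : c < 1 / 2
  /-- The capacity structure. -/
  K : ℕ → ℕ
  K_eventually_pos : ∃ N, ∀ n, N < n → 0 < K n

/-- The expected payoff of action `y` (gross of the cost of observation, which is sunk) if state `1`
has probability `p`. -/
def actPayoff (p : ℝ) (y : Bool) : ℝ :=
  if y = true then p else 1 - p

namespace Model

variable (G : Model)

/-- The neighborhoods which agent `n` may choose to observe (the empty one included). -/
def Nbhd (n : ℕ) : Type :=
  {B : Finset ℕ // B ⊆ Finset.range n ∧ B.card ≤ G.K n}

instance (n : ℕ) : MeasurableSpace (G.Nbhd n) := ⊤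

/-- A pure strategy profile: `obs n s` is the neighborhood which agent `n` chooses after the private
signal `s`; `act n s B h` is the action she takes at the information set that consists of the
private signal `s` and of the actions `h` observed in the neighborhood `B`. -/
structure Profile where
  obs : (n : ℕ) → Signal → G.Nbhd n
  act : (n : ℕ) → Signal → (B : G.Nbhd n) → ((b : ℕ) → b ∈ B.1 → Bool) → Bool
  measurable_obs : ∀ n, Measurable (obs n)
  measurable_act : ∀ n B h, Measurable fun s => act n s B h

/-- A system of beliefs: the probability that each agent assigns to state `1` at each of her
information sets. -/
def Beliefs : Type :=
  (n : ℕ) → Signal → (B : G.Nbhd n) → ((b : ℕ) → b ∈ B.1 → Bool) → ℝ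

namespace Profile

variable {G} (σ : G.Profile)

/-- The action of agent `n` under the profile, when the private signals are `s`. -/
def action (s : ℕ → Signal) (n : ℕ) : Bool :=
  σ.act n (s n) (σ.obs n (s n)) fun b _ => action s b
termination_by n
decreasing_by exact Finset.mem_range.1 ((σ.obs n (s n)).2.1 ‹_›)

/-- The network topology: the sequence of the observed neighborhoods. -/
def network (s : ℕ → Signal) : (n : ℕ) → G.Nbhd n :=
  fun n => σ.obs n (s n)

theorem measurable_network : Measurable σ.network :=
  measurable_pi_lambda _ fun n => (σ.measurable_obs n).comp (measurable_pi_apply n)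

/-- The probability measure which the profile generates on network topologies. -/
def networkLaw : Measure ((n : ℕ) → G.Nbhd n) :=
  G.prior.map fun ω => σ.network ω.2

/-- The probability, given the state `θ`, that the actions taken in `B` are `h`. -/
def histProb {n : ℕ} (B : G.Nbhd n) (h : (b : ℕ) → b ∈ B.1 → Bool) (θ : Bool) : ℝ :=
  (G.signalsLaw θ).real {s | ∀ b (hb : b ∈ B.1), σ.action s b = h b hb}

/-- The expected payoff of agent `n` when she chooses the neighborhood `B` after the private signal
`t` and then acts according to `σ.act n`: the conditional probability, given the signal, that her
action equals the state, less the cost if she observes. (Given the state, the actions of her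
predecessors are independent of her signal.) -/
def obsPayoff (n : ℕ) (t : Signal) (B : G.Nbhd n) : ℝ :=
  (∑ θ : Bool, G.privateBelief θ t *
      (G.signalsLaw θ).real {s | σ.act n t B (fun b _ => σ.action s b) = θ})
    - if B.1 = ∅ then 0 else G.c

/-- Beliefs are probabilities, and they follow from the strategies by Bayes' rule wherever the
observed actions have positive probability. -/
def Consistent (μ : G.Beliefs) : Prop :=
  ∀ n (t : Signal) (B : G.Nbhd n) (h : (b : ℕ) → b ∈ B.1 → Bool),
    μ n t B h ∈ Icc (0 : ℝ) 1 ∧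
    (0 < σ.histProb B h false + σ.histProb B h true →
      μ n t B h = G.f true t * σ.histProb B h true /
        (G.f false t * σ.histProb B h false + G.f true t * σ.histProb B h true))

/-- Pure strategy perfect Bayesian equilibrium. -/
def IsPBE : Prop :=
  ∃ μ : G.Beliefs, σ.Consistent μ ∧
    (∀ n (t : Signal) (B : G.Nbhd n) (h : (b : ℕ) → b ∈ B.1 → Bool) (y : Bool),
      actPayoff (μ n t B h) y ≤ actPayoff (μ n t B h) (σ.act n t B h)) ∧
    (∀ n (t : Signal) (B : G.Nbhd n), σ.obsPayoff n t B ≤ σ.obsPayoff n t (σ.obs n t))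

/-- Observation decisions agree at opposite signals. -/
def IsSymmetric : Prop :=
  ∀ n (t : Signal), 0 ≤ (t : ℝ) → σ.obs n t = σ.obs n (-t)

/-- An equilibrium is a pure strategy symmetric perfect Bayesian equilibrium. -/
def IsEquilibrium : Prop :=
  σ.IsPBE ∧ σ.IsSymmetric

/-- Expanding observations. The maximum of the empty neighborhood is `⊥`, which is below every
`M`: an agent who observes nobody does not observe anyone at or after `M`. -/
def ExpandingObservations : Prop :=
  ∀ M : ℕ, Tendsto (fun n => σ.networkLaw {B | (B n).1.max < (M : WithBot ℕ)}) atTop (𝓝 0)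

end Profile

end Model

end SocialLearning

end

/-! Free observation together with unbounded beliefs forces learning, and learning makes early
agents insufficient to observe. Learning: an agent who may observe `m` can copy her, or ignore her
and bet on `θ` when the signal strongly favours `θ`. Summed over states, accuracy therefore rises by
at least `overruleGain θ` of the error of `m` in state `θ` (`sum_accuracy_add_le`). The sums are
bounded, so the gains vanish. As `overruleGain` is monotone and positive at positive errors, both
accuracies tend to one (`tendsto_accuracy`). Insufficiency: some play of the first `M` agents has
positive probability in both states, so any rule based on them alone errs with probability bounded
below, uniformly in `n` (`exists_early_bound`). At a fixed signal, copying agent `n - 1` eventually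
beats every such rule, so the chosen neighborhood reaches `M` or beyond. Pointwise convergence in
the signal then gives convergence in probability. Payoffs given a signal `t` are handled without the
Bayes denominator `f false t + f true t`. -/

noncomputable section

namespace SocialLearning

namespace SignalStructure

/-! ### Signal laws, resampling, and the gain from overruling. -/

variable (F : SignalStructure)

instance (θ : Bool) : IsProbabilityMeasure (F.signalsLaw θ) := by
  unfold signalsLaw; infer_instance

/-- Lebesgue measure on the signal space. -/
def lebesgue : Measure Signal := (volume : Measure ℝ).comap Subtype.val

theorem pos' (θ : Bool) (t : Signal) : 0 < F.f θ t := F.pos θ t t.2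

theorem continuous_density (θ : Bool) : Continuous fun t : Signal => F.f θ t :=
  continuousOn_iff_continuous_domRestrict.1 (F.continuousOn θ)

theorem measurable_density (θ : Bool) : Measurable fun t : Signal => F.f θ t :=
  (F.continuous_density θ).measurable

theorem lebesgue_pos_of_isOpen {U : Set Signal} (hU : IsOpen U) (hne : U.Nonempty) :
    0 < lebesgue U := by
  rw [lebesgue, Measure.comap_apply _ Subtype.val_injective
    (fun s hs => measurableSet_Ioo.subtype_image hs) _ hU.measurableSet]
  exact (isOpen_Ioo.isOpenMap_subtype_val U hU).measure_pos _ (hne.image _)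

theorem integrable_iff_density {θ : Bool} {g : Signal → ℝ} :
    Integrable g (F.signalLaw θ) ↔ Integrable (fun t : Signal => F.f θ t * g t) lebesgue := by
  rw [signalLaw, integrable_withDensity_iff_integrable_smul'
    (F.measurable_density θ).ennreal_ofReal (by simp)]
  simp only [ENNReal.toReal_ofReal (F.pos' _ _).le, smul_eq_mul, lebesgue]

theorem integral_signalLaw (θ : Bool) (g : Signal → ℝ) :
    ∫ t, g t ∂F.signalLaw θ = ∫ t : Signal, F.f θ t * g t ∂lebesgue := by
  rw [signalLaw, integral_withDensity_eq_integral_toReal_smul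
    (F.measurable_density θ).ennreal_ofReal (by simp)]
  simp only [ENNReal.toReal_ofReal (F.pos' _ _).le, smul_eq_mul, lebesgue]

theorem integrable_density (θ : Bool) : Integrable (fun t : Signal => F.f θ t) lebesgue := by
  have := (F.integrable_iff_density (θ := θ) (g := fun _ => 1)).1 (integrable_const _)
  simpa using this

theorem integral_density (θ : Bool) : ∫ t : Signal, F.f θ t ∂lebesgue = 1 := by
  have := F.integral_signalLaw θ (fun _ => 1)
  simpa using this.symm

/-- Positive densities make both signal laws equivalent to Lebesgue measure, so no signal event of
positive probability reveals the state. -/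
theorem signalLaw_pos_of_pos {θ : Bool} (θ' : Bool) {E : Set Signal}
    (h : 0 < F.signalLaw θ E) : 0 < F.signalLaw θ' E := by
  have h1 : F.signalLaw θ ≪ lebesgue := withDensity_absolutelyContinuous _ _
  have h2 : lebesgue ≪ F.signalLaw θ' := by
    refine withDensity_absolutelyContinuous' (F.measurable_density θ').ennreal_ofReal.aemeasurable
      (ae_of_all _ fun t => ?_)
    simpa using F.pos' θ' t
  exact pos_iff_ne_zero.2 fun h0 => h.ne' (h1 (h2 h0))

theorem measurable_update (n : ℕ) :
    Measurable fun p : (ℕ → Signal) × Signal => Function.update p.1 n p.2 := by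
  refine measurable_pi_lambda _ fun i => ?_
  by_cases h : i = n
  · subst h; simpa using measurable_snd
  · simp only [Function.update_of_ne h]
    exact (measurable_pi_apply i).comp measurable_fst

/-- Resampling one signal does not change the law of the signals. -/
theorem map_update_signalsLaw (θ : Bool) (n : ℕ) :
    ((F.signalsLaw θ).prod (F.signalLaw θ)).map (fun p => Function.update p.1 n p.2) =
      F.signalsLaw θ := by
  have hm := measurable_update n
  refine Measure.eq_infinitePi _ fun I T hT => ?_
  rw [Measure.map_apply hm (MeasurableSet.pi I.countable_toSet fun i _ => hT i)]
  -- The old coordinate `n` is overwritten, hence unconstrained; the fresh signal takes over its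
  -- constraint.
  have hset : (fun p : (ℕ → Signal) × Signal => Function.update p.1 n p.2) ⁻¹' (Set.pi I T) =
      (Set.pi (I.erase n : Finset ℕ) T) ×ˢ (if n ∈ I then T n else univ) := by
    ext ⟨s, t⟩
    simp only [mem_preimage, Set.mem_pi, Finset.mem_coe, mem_prod, Finset.mem_erase]
    constructor
    · intro h
      refine ⟨fun i hi => by simpa [Function.update_of_ne hi.1] using h i hi.2, ?_⟩
      split_ifs with hn
      · simpa using h n hn
      · trivial
    · rintro ⟨h1, h2⟩ i hi
      by_cases h : i = n
      · subst h; simpa [hi] using h2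
      · simpa [Function.update_of_ne h] using h1 i ⟨h, hi⟩
  rw [hset, Measure.prod_prod, signalsLaw, Measure.infinitePi_pi _ fun i _ => hT i]
  split_ifs with hn
  · rw [mul_comm]; exact Finset.mul_prod_erase I (fun i => F.signalLaw θ (T i)) hn
  · rw [Finset.erase_eq_of_notMem hn, measure_univ, mul_one]

/-- Expected gain, up to normalization, from following strong signals in favour of state `θ`
instead of a source that misses state `θ` with probability `e`. -/
def overruleGain (θ : Bool) (e : ℝ) : ℝ :=
  ∫ t : Signal, max 0 (F.f θ t * e - F.f (!θ) t) ∂lebesgue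

theorem integrable_overruleGain (θ : Bool) (e : ℝ) :
    Integrable (fun t : Signal => max 0 (F.f θ t * e - F.f (!θ) t)) lebesgue := by
  have := ((F.integrable_density θ).mul_const e).sub (F.integrable_density (!θ))
  exact (integrable_zero _ _ _).sup this

theorem overruleGain_nonneg (θ : Bool) (e : ℝ) : 0 ≤ F.overruleGain θ e :=
  integral_nonneg fun _ => le_max_left _ _

theorem overruleGain_mono (θ : Bool) : Monotone (F.overruleGain θ) := fun a b h =>
  integral_mono (F.integrable_overruleGain θ a) (F.integrable_overruleGain θ b) fun t =>
    max_le_max le_rfl (sub_le_sub_right (mul_le_mul_of_nonneg_left h (F.pos' θ t).le) _)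

/-- The likelihood ratio in favour of `θ` exceeds `1 / e` exactly when the belief in `θ` exceeds `1
/ (1 + e)`, which is below one. -/
theorem exists_density_lt (hunb : F.UnboundedPrivateBeliefs) (θ : Bool) {e : ℝ} (he : 0 < e) :
    ∃ t : Signal, F.f (!θ) t < F.f θ t * e := by
  cases θ
  · have h1 : ∀ᶠ s in 𝓝[>] (-1 : ℝ), F.privateBelief true s < e / (1 + e) :=
      hunb.2.eventually_lt_const (by positivity)
    obtain ⟨s, hs, hI⟩ := (h1.and (Ioo_mem_nhdsGT (show (-1 : ℝ) < 1 by norm_num))).exists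
    refine ⟨⟨s, hI⟩, ?_⟩
    have h2 := F.pos false s hI
    have h3 := F.pos true s hI
    rw [privateBelief, div_lt_div_iff₀ (by positivity) (by positivity)] at hs
    simp only [Bool.not_false]
    nlinarith
  · have h1 : ∀ᶠ s in 𝓝[<] (1 : ℝ), 1 / (1 + e) < F.privateBelief true s :=
      hunb.1.eventually_const_lt (by rw [div_lt_one (by positivity)]; linarith)
    obtain ⟨s, hs, hI⟩ := (h1.and (Ioo_mem_nhdsLT (show (-1 : ℝ) < 1 by norm_num))).exists
    refine ⟨⟨s, hI⟩, ?_⟩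
    have h2 := F.pos false s hI
    have h3 := F.pos true s hI
    rw [privateBelief, div_lt_div_iff₀ (by positivity) (by positivity)] at hs
    simp only [Bool.not_true]
    nlinarith

theorem overruleGain_pos (hunb : F.UnboundedPrivateBeliefs) (θ : Bool) {e : ℝ} (he : 0 < e) :
    0 < F.overruleGain θ e := by
  rw [overruleGain, integral_pos_iff_support_of_nonneg
    (f := fun t : Signal => max 0 (F.f θ t * e - F.f (!θ) t)) (fun _ => le_max_left _ _)
    (F.integrable_overruleGain θ e)]
  have hU : IsOpen {t : Signal | F.f (!θ) t < F.f θ t * e} :=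
    isOpen_lt (F.continuous_density _) ((F.continuous_density _).mul continuous_const)
  refine (lebesgue_pos_of_isOpen hU (F.exists_density_lt hunb θ he)).trans_le (measure_mono ?_)
  intro t ht
  exact (lt_max_of_lt_right (sub_pos.2 ht)).ne'

end SignalStructure

end SocialLearning
end

noncomputable section

namespace SocialLearning

namespace Model

/-! ### Measurability of play and sequential rationality. -/

variable (G : Model)

instance (n : ℕ) : Finite (G.Nbhd n) :=
  Finite.of_injective
    (fun B : G.Nbhd n => (⟨B.1, Finset.mem_powerset.2 B.2.1⟩ : (Finset.range n).powerset))
    fun _ _ h => Subtype.ext (congrArg (fun x => x.1) h)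

variable {G}

/-- The actions observed in a neighborhood. -/
abbrev Hist {n : ℕ} (B : G.Nbhd n) : Type := (b : ℕ) → b ∈ B.1 → Bool

instance {n : ℕ} (B : G.Nbhd n) : Finite (Hist B) :=
  Finite.of_injective (fun (h : Hist B) (b : B.1) => h b b.2)
    fun _ _ e => funext fun b => funext fun hb => congrFun e ⟨b, hb⟩

theorem Nbhd.lt {n : ℕ} (B : G.Nbhd n) {b : ℕ} (hb : b ∈ B.1) : b < n :=
  Finset.mem_range.1 (B.2.1 hb)

namespace Profile

variable (σ : G.Profile)

theorem action_eq (s : ℕ → Signal) (n : ℕ) :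
    σ.action s n = σ.act n (s n) (σ.obs n (s n)) fun b _ => σ.action s b := by
  rw [action]

theorem action_congr {s t : ℕ → Signal} (n : ℕ) (h : ∀ i ≤ n, s i = t i) :
    σ.action s n = σ.action t n := by
  induction n using Nat.strong_induction_on with
  | _ n ih =>
    rw [action_eq, action_eq, h n le_rfl]
    congr 1
    funext b hb
    have hbn := Nbhd.lt _ hb
    exact ih b hbn fun i hi => h i (hi.trans hbn.le)

theorem action_update_of_lt (s : ℕ → Signal) {m n : ℕ} (h : m < n) (t : Signal) :
    σ.action (Function.update s n t) m = σ.action s m :=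
  σ.action_congr m fun i hi => Function.update_of_ne (by omega) _ _

theorem action_update_self (s : ℕ → Signal) (n : ℕ) (t : Signal) :
    σ.action (Function.update s n t) n =
      σ.act n t (σ.obs n t) fun b _ => σ.action s b := by
  rw [action_eq, Function.update_self]
  congr 1
  funext b hb
  exact σ.action_update_of_lt s (Nbhd.lt _ hb) t

theorem measurableSet_hist {n : ℕ} (hm : ∀ m < n, Measurable fun s => σ.action s m)
    (B : G.Nbhd n) (h : Hist B) :
    MeasurableSet {s | ∀ b (hb : b ∈ B.1), σ.action s b = h b hb} := by
  simp only [ofPred_forall]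
  exact MeasurableSet.iInter fun b => MeasurableSet.iInter fun hb =>
    hm b (Nbhd.lt _ hb) (measurableSet_singleton (h b hb))

/-- Separating the signals behind the history from the agent's own signal makes each level set a
finite union of rectangles, and later allows Fubini. -/
theorem measurable_act_hist {n : ℕ} (hm : ∀ m < n, Measurable fun s => σ.action s m) :
    Measurable fun p : (ℕ → Signal) × Signal =>
      σ.act n p.2 (σ.obs n p.2) fun b _ => σ.action p.1 b := by
  refine measurable_to_countable' fun y => ?_
  have : (fun p : (ℕ → Signal) × Signal =>
      σ.act n p.2 (σ.obs n p.2) fun b _ => σ.action p.1 b) ⁻¹' {y} =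
      ⋃ B : G.Nbhd n, ⋃ h : Hist B,
        {s | ∀ b (hb : b ∈ B.1), σ.action s b = h b hb} ×ˢ
          (σ.obs n ⁻¹' {B} ∩ (fun t => σ.act n t B h) ⁻¹' {y}) := by
    ext ⟨s, t⟩
    simp only [mem_preimage, mem_singleton_iff, mem_iUnion, mem_prod, mem_ofPred_eq, mem_inter_iff]
    constructor
    · intro hy
      exact ⟨σ.obs n t, fun b _ => σ.action s b, fun _ _ => rfl, rfl, hy⟩
    · rintro ⟨B, h, hh, rfl, hy⟩
      rw [← hy]
      congr 1
      funext b hb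
      exact hh b hb
  rw [this]
  refine MeasurableSet.iUnion fun B => MeasurableSet.iUnion fun h => ?_
  exact (σ.measurableSet_hist hm B h).prod
    ((σ.measurable_obs n (measurableSet_singleton _)).inter
      (σ.measurable_act n B h (measurableSet_singleton _)))

theorem measurable_action (n : ℕ) : Measurable fun s => σ.action s n := by
  induction n using Nat.strong_induction_on with
  | _ n ih =>
    have : (fun s => σ.action s n) = (fun p : (ℕ → Signal) × Signal =>
        σ.act n p.2 (σ.obs n p.2) fun b _ => σ.action p.1 b) ∘ fun s => (s, s n) :=
      funext fun s => σ.action_eq s n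
    rw [this]
    exact (σ.measurable_act_hist ih).comp (measurable_id.prodMk (measurable_pi_apply n))

/-- The probability, given the state `θ`, that the decision rule `d` applied to the actions
observed in `B` yields the action `y`. -/
def ruleProb {n : ℕ} (B : G.Nbhd n) (d : Hist B → Bool) (θ y : Bool) : ℝ :=
  (G.signalsLaw θ).real {s | d (fun b _ => σ.action s b) = y}

theorem ruleProb_eq_sum {n : ℕ} (B : G.Nbhd n) [Fintype (Hist B)] (d : Hist B → Bool)
    (θ y : Bool) :
    σ.ruleProb B d θ y = ∑ h : Hist B, if d h = y then σ.histProb B h θ else 0 := by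
  have hset : {s | d (fun b _ => σ.action s b) = y} =
      ⋃ h ∈ Finset.univ.filter (fun h : Hist B => d h = y),
        {s | ∀ b (hb : b ∈ B.1), σ.action s b = h b hb} := by
    ext s
    simp only [mem_ofPred_eq, mem_iUnion, Finset.mem_filter, Finset.mem_univ, true_and, exists_prop]
    constructor
    · intro hy
      exact ⟨_, hy, fun _ _ => rfl⟩
    · rintro ⟨h, hy, hh⟩
      rw [← hy]
      congr 1
      funext b hb
      exact hh b hb
  rw [ruleProb, hset, measureReal_biUnion_finset, Finset.sum_filter]
  · rfl
  · intro h _ h' _ hne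
    refine disjoint_left.2 fun s hs hs' => hne ?_
    funext b hb
    exact (hs b hb).symm.trans (hs' b hb)
  · exact fun h _ => σ.measurableSet_hist (fun m _ => σ.measurable_action m) B h

theorem histProb_nonneg {n : ℕ} (B : G.Nbhd n) (h : Hist B) (θ : Bool) : 0 ≤ σ.histProb B h θ :=
  measureReal_nonneg

variable {σ}

/-- Sequential rationality: the equilibrium action rule is at least as good as any other. -/
theorem IsPBE.sum_density_ruleProb_le (hσ : σ.IsPBE) {n : ℕ} (t : Signal) (B : G.Nbhd n)
    (d : Hist B → Bool) :
    ∑ θ : Bool, G.f θ t * σ.ruleProb B d θ θ ≤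
      ∑ θ : Bool, G.f θ t * σ.ruleProb B (σ.act n t B) θ θ := by
  obtain ⟨μ, hμ, hact, -⟩ := hσ
  have : Fintype (Hist B) := Fintype.ofFinite _
  simp only [ruleProb_eq_sum, Fintype.sum_bool, Finset.mul_sum, ← Finset.sum_add_distrib]
  refine Finset.sum_le_sum fun h _ => ?_
  have h0 := σ.histProb_nonneg B h false
  have h1 := σ.histProb_nonneg B h true
  have hp0 := G.pos' false t
  have hp1 := G.pos' true t
  -- Bayes' rule is silent at null histories, but these contribute nothing to either side.
  rcases (add_nonneg h0 h1).eq_or_lt with hz | hpos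
  · rw [show σ.histProb B h false = 0 by linarith, show σ.histProb B h true = 0 by linarith]
    simp
  · have hb := (hμ n t B h).2 hpos
    have hD : 0 < G.f false t * σ.histProb B h false + G.f true t * σ.histProb B h true := by
      rcases h0.eq_or_lt with hz | hz
      · rw [← hz] at hpos ⊢
        rw [zero_add] at hpos
        positivity
      · positivity
    have hm := hact n t B h (d h)
    have h3 : μ n t B h * (G.f false t * σ.histProb B h false + G.f true t * σ.histProb B h true)
        = G.f true t * σ.histProb B h true := by rw [hb, div_mul_cancel₀ _ hD.ne']
    have h4 := mul_le_mul_of_nonneg_right hm hD.le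
    revert h4
    cases d h <;> cases σ.act n t B h <;> simp [actPayoff, sub_mul, h3]

theorem obsPayoff_mul (hc : G.c = 0) (n : ℕ) (t : Signal) (B : G.Nbhd n) :
    σ.obsPayoff n t B * (G.f false t + G.f true t) =
      ∑ θ : Bool, G.f θ t * σ.ruleProb B (σ.act n t B) θ θ := by
  have hp0 := G.pos' false t
  have hp1 := G.pos' true t
  have : (G.f false t + G.f true t) ≠ 0 := by positivity
  simp only [obsPayoff, hc, ite_self, sub_zero, Fintype.sum_bool, SignalStructure.privateBelief,
    ruleProb]
  field_simp

/-- At zero cost, equilibrium play at each signal beats every pair of a feasible neighborhood and a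
decision rule. -/
theorem IsPBE.sum_density_ruleProb_le_obs (hσ : σ.IsPBE) (hc : G.c = 0) {n : ℕ} (t : Signal)
    (B : G.Nbhd n) (d : Hist B → Bool) :
    ∑ θ : Bool, G.f θ t * σ.ruleProb B d θ θ ≤
      ∑ θ : Bool, G.f θ t * σ.ruleProb (σ.obs n t) (σ.act n t (σ.obs n t)) θ θ := by
  refine (hσ.sum_density_ruleProb_le t B d).trans ?_
  rw [← obsPayoff_mul hc, ← obsPayoff_mul hc]
  obtain ⟨μ, -, -, hobs⟩ := hσ
  exact mul_le_mul_of_nonneg_right (hobs n t B) (add_pos (G.pos' _ t) (G.pos' _ t)).le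

variable (σ)

/-- The probability that agent `n` acts correctly in state `θ`. -/
def accuracy (n : ℕ) (θ : Bool) : ℝ :=
  (G.signalsLaw θ).real {s | σ.action s n = θ}

theorem accuracy_le_one (n : ℕ) (θ : Bool) : σ.accuracy n θ ≤ 1 := measureReal_le_one

theorem measurableSet_act_hist (n : ℕ) (y : Bool) :
    MeasurableSet {p : (ℕ → Signal) × Signal |
      σ.act n p.2 (σ.obs n p.2) (fun b _ => σ.action p.1 b) = y} :=
  σ.measurable_act_hist (fun m _ => σ.measurable_action m) (measurableSet_singleton y)

theorem measurable_ruleProb_obs (n : ℕ) (θ : Bool) :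
    Measurable fun t => σ.ruleProb (σ.obs n t) (σ.act n t (σ.obs n t)) θ θ :=
  (measurable_measure_prodMk_right (μ := G.signalsLaw θ)
    (σ.measurableSet_act_hist n θ)).ennreal_toReal

theorem integrable_ruleProb_obs (n : ℕ) (θ : Bool) :
    Integrable (fun t => σ.ruleProb (σ.obs n t) (σ.act n t (σ.obs n t)) θ θ) (G.signalLaw θ) :=
  Integrable.of_bound (σ.measurable_ruleProb_obs n θ).aestronglyMeasurable 1
    (ae_of_all _ fun _ => by
      rw [ruleProb, Real.norm_of_nonneg measureReal_nonneg]; exact measureReal_le_one)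

theorem accuracy_eq_integral (n : ℕ) (θ : Bool) :
    σ.accuracy n θ =
      ∫ t, σ.ruleProb (σ.obs n t) (σ.act n t (σ.obs n t)) θ θ ∂G.signalLaw θ := by
  have h1 : G.signalsLaw θ {s | σ.action s n = θ} =
      ∫⁻ t, G.signalsLaw θ {s | σ.act n t (σ.obs n t) (fun b _ => σ.action s b) = θ}
        ∂G.signalLaw θ := by
    have hms : MeasurableSet {s | σ.action s n = θ} :=
      σ.measurable_action n (measurableSet_singleton θ)
    -- Resampling signal `n` expresses its independence from the predecessors' actions.
    conv_lhs => rw [← G.map_update_signalsLaw θ n]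
    rw [Measure.map_apply (SignalStructure.measurable_update n) hms]
    have : (fun p : (ℕ → Signal) × Signal => Function.update p.1 n p.2) ⁻¹'
        {s | σ.action s n = θ} =
        {p | σ.act n p.2 (σ.obs n p.2) (fun b _ => σ.action p.1 b) = θ} := by
      ext p
      simp only [mem_preimage, mem_ofPred_eq, action_update_self]
    rw [this, Measure.prod_apply_symm (σ.measurableSet_act_hist n θ)]
    rfl
  rw [accuracy, Measure.real, h1]
  refine (integral_toReal ?_ (ae_of_all _ fun _ => measure_lt_top _ _)).symm
  exact (measurable_measure_prodMk_right (σ.measurableSet_act_hist n θ)).aemeasurable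

end Profile

end Model

end SocialLearning
end

noncomputable section

namespace SocialLearning

namespace Model

variable {G : Model}

namespace Profile

/-! ### Asymptotic learning by imitation and overruling. -/

variable (σ : G.Profile)

theorem sum_accuracy_eq_integral (n : ℕ) :
    ∑ θ : Bool, σ.accuracy n θ = ∫ t : Signal,
      ∑ θ : Bool, G.f θ t * σ.ruleProb (σ.obs n t) (σ.act n t (σ.obs n t)) θ θ
        ∂SignalStructure.lebesgue := by
  rw [integral_finsetSum _ fun θ _ => G.integrable_iff_density.1 (σ.integrable_ruleProb_obs n θ)]
  simp only [accuracy_eq_integral, SignalStructure.integral_signalLaw]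

variable {σ}

/-- Observing `m` alone is feasible; `d = id` copies her and a constant `d` overrules her. -/
theorem IsPBE.imitate_le (hσ : σ.IsPBE) (hc : G.c = 0) {m n : ℕ} (hmn : m < n) (hK : 0 < G.K n)
    (t : Signal) (d : Bool → Bool) :
    ∑ θ : Bool, G.f θ t * (G.signalsLaw θ).real {s | d (σ.action s m) = θ} ≤
      ∑ θ : Bool, G.f θ t * σ.ruleProb (σ.obs n t) (σ.act n t (σ.obs n t)) θ θ := by
  let B : G.Nbhd n := ⟨{m}, by simpa using hmn, by
    simpa using Nat.succ_le_of_lt hK⟩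
  exact hσ.sum_density_ruleProb_le_obs hc t B fun h => d (h m (Finset.mem_singleton_self m))

/-- An agent who may observe a predecessor at no cost is more accurate than that predecessor, by at
least the gain from overruling her after strong signals. -/
theorem IsPBE.sum_accuracy_add_le (hσ : σ.IsPBE) (hc : G.c = 0) {m n : ℕ} (hmn : m < n)
    (hK : 0 < G.K n) (θ : Bool) :
    ∑ ω : Bool, σ.accuracy m ω + G.overruleGain θ (1 - σ.accuracy m θ) ≤
      ∑ ω : Bool, σ.accuracy n ω := by
  have hint : ∀ ω, Integrable (fun t : Signal => G.f ω t * σ.accuracy m ω)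
      SignalStructure.lebesgue := fun ω => (G.integrable_density ω).mul_const _
  have h1 : ∑ ω : Bool, σ.accuracy m ω =
      ∫ t : Signal, ∑ ω : Bool, G.f ω t * σ.accuracy m ω ∂SignalStructure.lebesgue := by
    rw [integral_finsetSum _ fun ω _ => hint ω]
    simp only [integral_mul_const, G.integral_density, one_mul]
  rw [h1, SignalStructure.overruleGain,
    ← integral_add (integrable_finsetSum _ fun ω _ => hint ω) (G.integrable_overruleGain θ _),
    sum_accuracy_eq_integral]
  refine integral_mono
    ((integrable_finsetSum _ fun ω _ => hint ω).add (G.integrable_overruleGain θ _))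
    (integrable_finsetSum _ fun ω _ =>
      G.integrable_iff_density.1 (σ.integrable_ruleProb_obs n ω)) fun t => ?_
  have hfollow := hσ.imitate_le hc hmn hK t id
  have hoverrule := hσ.imitate_le hc hmn hK t fun _ => θ
  have hle : G.f (!θ) t * σ.accuracy m (!θ) ≤ G.f (!θ) t :=
    mul_le_of_le_one_right (G.pos' _ t).le (σ.accuracy_le_one m _)
  simp only [id] at hfollow
  change ∑ ω : Bool, G.f ω t * σ.accuracy m ω ≤ _ at hfollow
  change ∑ ω : Bool, G.f ω t * σ.accuracy m ω + max _ _ ≤ _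
  -- Copying covers the zero branch. In the other, always playing `θ` yields `f θ t`, and `hle`
  -- bounds what is given up in state `!θ`.
  rcases max_cases 0 (G.f θ t * (1 - σ.accuracy m θ) - G.f (!θ) t) with h | h
  · rw [h.1, add_zero]; exact hfollow
  · rw [h.1]
    refine le_trans ?_ hoverrule
    cases θ <;> simp at hle ⊢ <;> linarith

/-- Asymptotic learning: accuracies tend to one. -/
theorem IsPBE.tendsto_accuracy (hσ : σ.IsPBE) (hc : G.c = 0) (hunb : G.UnboundedPrivateBeliefs)
    (θ : Bool) : Tendsto (fun n => σ.accuracy n θ) atTop (𝓝 1) := by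
  obtain ⟨N, hN⟩ := G.K_eventually_pos
  have hstep : ∀ n, N ≤ n → ∑ ω : Bool, σ.accuracy n ω +
      G.overruleGain θ (1 - σ.accuracy n θ) ≤ ∑ ω : Bool, σ.accuracy (n + 1) ω := fun n hn =>
    hσ.sum_accuracy_add_le hc n.lt_succ_self (hN _ (by omega)) θ
  have hmono : Monotone fun k => ∑ ω : Bool, σ.accuracy (N + k) ω :=
    monotone_nat_of_le_succ fun k =>
      (le_add_of_nonneg_right (G.overruleGain_nonneg _ _)).trans (hstep (N + k) (by omega))
  have hbdd : BddAbove (range fun k => ∑ ω : Bool, σ.accuracy (N + k) ω) := by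
    refine ⟨2, ?_⟩
    rintro _ ⟨k, rfl⟩
    have h0 := σ.accuracy_le_one (N + k) false
    have h1 := σ.accuracy_le_one (N + k) true
    simp only [Fintype.sum_bool]
    linarith
  have hlim := tendsto_atTop_ciSup hmono hbdd
  have hdiff := (hlim.comp (tendsto_add_atTop_nat 1)).sub hlim
  rw [sub_self] at hdiff
  have hshift : Tendsto (fun k => σ.accuracy (k + N) θ) atTop (𝓝 1) := by
    refine tendsto_order.2 ⟨fun a ha => ?_, fun a ha =>
      Eventually.of_forall fun k => (σ.accuracy_le_one _ _).trans_lt ha⟩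
    -- An accuracy of at most `a` would force an increment of at least `overruleGain θ (1 - a)`,
    -- while increments tend to zero.
    filter_upwards [hdiff.eventually_lt_const (G.overruleGain_pos hunb θ (sub_pos.2 ha))] with k hk
    by_contra! hle
    have h1 := G.overruleGain_mono θ (sub_le_sub_left hle 1)
    have h2 := hstep (k + N) (by omega)
    simp only [Function.comp_apply, ← add_assoc, add_comm N k] at hk
    rw [add_right_comm] at h2
    rw [add_right_comm k N 1] at hk
    linarith
  exact (tendsto_add_atTop_iff_nat N).1 hshift

/-! ### Limits of observing only early agents. -/

variable (σ)

/-- Some sequence of actions of the first `M` agents has positive probability in both states. -/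
theorem exists_common_history (M : ℕ) : ∃ w : ℕ → Bool, ∀ θ,
    0 < G.signalsLaw θ {s | ∀ b < M, σ.action s b = w b} := by
  induction M with
  | zero => exact ⟨fun _ => true, fun θ => by simp⟩
  | succ M ih =>
    obtain ⟨w, hw⟩ := ih
    let g : Signal → Bool := fun t => σ.act M t (σ.obs M t) fun b _ => w b
    have hcover : (univ : Set Signal) = g ⁻¹' {false} ∪ g ⁻¹' {true} := by
      ext t
      cases h : g t <;> simp [h]
    have hg : Measurable g := by
      refine measurable_to_countable' fun y => ?_
      have : g ⁻¹' {y} = ⋃ B : G.Nbhd M,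
          σ.obs M ⁻¹' {B} ∩ (fun t => σ.act M t B fun b _ => w b) ⁻¹' {y} := by
        ext t
        simp [g]
      rw [this]
      exact MeasurableSet.iUnion fun B => (σ.measurable_obs M (measurableSet_singleton _)).inter
        (σ.measurable_act M B _ (measurableSet_singleton _))
    -- After `w`, agent `M` plays some `y` with positive probability in one state, hence in both.
    obtain ⟨y, hy⟩ : ∃ y, 0 < G.signalLaw false (g ⁻¹' {y}) := by
      by_contra! h
      have h1 := measure_union_null (nonpos_iff_eq_zero.1 (h false))
        (nonpos_iff_eq_zero.1 (h true))
      rw [← hcover, measure_univ] at h1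
      exact one_ne_zero h1
    refine ⟨Function.update w M y, fun θ => ?_⟩
    have hpos := ENNReal.mul_pos (hw θ).ne' (G.signalLaw_pos_of_pos θ hy).ne'
    rw [← Measure.prod_prod] at hpos
    refine hpos.trans_le ?_
    conv_rhs => rw [← G.map_update_signalsLaw θ M]
    refine (measure_mono ?_).trans
      (Measure.le_map_apply (SignalStructure.measurable_update M).aemeasurable _)
    rintro ⟨s, t⟩ ⟨hs, ht⟩ b hb
    simp only [mem_ofPred_eq] at hs
    rcases Nat.lt_succ_iff_lt_or_eq.1 hb with h | rfl
    · rw [σ.action_update_of_lt s h t, hs b h, Function.update_of_ne h.ne]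
    · rw [action_update_self, Function.update_self]
      refine Eq.trans ?_ ht
      congr 1
      funext i hi
      exact hs i (Nbhd.lt _ hi)

/-- The payoff from observing early agents only is bounded away from that of perfect learning. -/
theorem exists_early_bound (t : Signal) (M : ℕ) : ∃ δ > 0, ∀ n (B : G.Nbhd n) (d : Hist B → Bool),
    (∀ b ∈ B.1, b < M) →
      ∑ θ : Bool, G.f θ t * σ.ruleProb B d θ θ ≤ G.f false t + G.f true t - δ := by
  obtain ⟨w, hw⟩ := σ.exists_common_history M
  let q : Bool → ℝ := fun θ => (G.signalsLaw θ).real {s | ∀ b < M, σ.action s b = w b}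
  have hq : ∀ θ, 0 < q θ := fun θ => ENNReal.toReal_pos (hw θ).ne' (measure_ne_top _ _)
  -- The rule answers `w` with a single action, so it loses at least `f θ t * q θ` in the other
  -- state `θ`; the minimum covers both cases and does not depend on `n`, `B` or `d`.
  refine ⟨min (G.f false t * q false) (G.f true t * q true),
    lt_min (mul_pos (G.pos' _ t) (hq _)) (mul_pos (G.pos' _ t) (hq _)), fun n B d hB => ?_⟩
  have hone : ∀ θ, G.f θ t * σ.ruleProb B d θ θ ≤ G.f θ t := fun θ =>
    mul_le_of_le_one_right (G.pos' θ t).le measureReal_le_one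
  have hmiss : ∀ θ, d (fun b _ => w b) ≠ θ → G.f θ t * σ.ruleProb B d θ θ ≤
      G.f θ t - G.f θ t * q θ := by
    intro θ hθ
    rw [← mul_one_sub]
    refine mul_le_mul_of_nonneg_left ?_ (G.pos' θ t).le
    have hms : MeasurableSet {s | ∀ b < M, σ.action s b = w b} := by
      simp only [ofPred_forall]
      exact MeasurableSet.iInter fun b => MeasurableSet.iInter fun _ =>
        σ.measurable_action b (measurableSet_singleton _)
    rw [← probReal_compl_eq_one_sub hms]
    refine measureReal_mono fun s hs hsw => hθ ?_
    rw [← show d (fun b _ => σ.action s b) = θ from hs]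
    congr 1
    funext b hb
    exact (hsw b (hB b hb)).symm
  rw [Fintype.sum_bool]
  cases hd : d fun b _ => w b
  · linarith [hone false, hmiss true (by simp [hd]),
      min_le_right (G.f false t * q false) (G.f true t * q true)]
  · linarith [hone true, hmiss false (by simp [hd]),
      min_le_left (G.f false t * q false) (G.f true t * q true)]

/-! ### From each signal to the network law. -/

variable {σ}

theorem IsPBE.eventually_observes_late (hσ : σ.IsPBE) (hc : G.c = 0)
    (hunb : G.UnboundedPrivateBeliefs) (t : Signal) (M : ℕ) :
    ∀ᶠ n in atTop, ¬ (σ.obs n t).1.max < (M : WithBot ℕ) := by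
  obtain ⟨δ, hδ, hbound⟩ := σ.exists_early_bound t M
  obtain ⟨N, hN⟩ := G.K_eventually_pos
  have hlim : Tendsto (fun n => ∑ θ : Bool, G.f θ t * σ.accuracy n θ) atTop
      (𝓝 (G.f false t + G.f true t)) := by
    have := tendsto_finsetSum (Finset.univ : Finset Bool) fun θ _ =>
      (hσ.tendsto_accuracy hc hunb θ).const_mul (G.f θ t)
    simpa [add_comm] using this
  filter_upwards [(hlim.comp (tendsto_sub_atTop_nat 1)).eventually_const_lt (sub_lt_self _ hδ),
    eventually_gt_atTop N] with n hn hNn hmax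
  have hearly : ∀ b ∈ (σ.obs n t).1, b < M := fun b hb =>
    WithBot.coe_lt_coe.1 ((Finset.le_max hb).trans_lt hmax)
  have himitate := hσ.imitate_le hc (show n - 1 < n by omega) (hN n hNn) t id
  exact absurd (hn.trans_le (himitate.trans (hbound n _ _ hearly))) (lt_irrefl _)

theorem measurableSet_obs_lt (σ : G.Profile) (n M : ℕ) :
    MeasurableSet {t | (σ.obs n t).1.max < (M : WithBot ℕ)} :=
  σ.measurable_obs n (MeasurableSpace.measurableSet_top
    (s := {B : G.Nbhd n | B.1.max < (M : WithBot ℕ)}))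

theorem networkLaw_obs_lt (σ : G.Profile) (n M : ℕ) :
    σ.networkLaw {B | (B n).1.max < (M : WithBot ℕ)} =
      2⁻¹ * ∑ θ : Bool, G.signalLaw θ {t | (σ.obs n t).1.max < (M : WithBot ℕ)} := by
  have hS : MeasurableSet {B : (n : ℕ) → G.Nbhd n | (B n).1.max < (M : WithBot ℕ)} :=
    measurable_pi_apply n (MeasurableSpace.measurableSet_top
      (s := {B : G.Nbhd n | B.1.max < (M : WithBot ℕ)}))
  have hm : Measurable fun ω : Bool × (ℕ → Signal) => σ.network ω.2 :=
    σ.measurable_network.comp measurable_snd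
  rw [networkLaw, Measure.map_apply hm hS, SignalStructure.prior, Measure.smul_apply,
    Measure.finsetSum_apply, smul_eq_mul]
  congr 1
  refine Finset.sum_congr rfl fun θ _ => ?_
  have hset : (fun ω : Bool × (ℕ → Signal) => σ.network ω.2) ⁻¹'
      {B | (B n).1.max < (M : WithBot ℕ)} =
      univ ×ˢ ((fun s : ℕ → Signal => s n) ⁻¹'
        {t | (σ.obs n t).1.max < (M : WithBot ℕ)}) := by
    ext ω
    simp [network]
  rw [hset, Measure.prod_prod, measure_univ, one_mul, ← Measure.map_apply (measurable_pi_apply n)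
    (σ.measurableSet_obs_lt n M), SignalStructure.signalsLaw, Measure.infinitePi_map_eval]

theorem IsPBE.expandingObservations (hσ : σ.IsPBE) (hc : G.c = 0)
    (hunb : G.UnboundedPrivateBeliefs) : σ.ExpandingObservations := by
  intro M
  simp only [networkLaw_obs_lt]
  have hlim : ∀ θ, Tendsto
      (fun n => G.signalLaw θ {t | (σ.obs n t).1.max < (M : WithBot ℕ)}) atTop (𝓝 0) := by
    intro θ
    rw [← measure_empty (μ := G.signalLaw θ)]
    -- The threshold for `n` depends on the signal, so dominated convergence is used in place of a
    -- uniform bound.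
    refine tendsto_measure_of_tendsto_indicator_of_isFiniteMeasure _ _
      (fun n => σ.measurableSet_obs_lt n M) fun t => ?_
    filter_upwards [hσ.eventually_observes_late hc hunb t M] with n hn
    simpa using hn
  have hsum := tendsto_finsetSum (Finset.univ : Finset Bool) fun θ _ => hlim θ
  simpa using ENNReal.Tendsto.const_mul (a := 2⁻¹) hsum (Or.inr (by simp))

end Profile

end Model

end SocialLearning
end

theorem corollary1 (G : SocialLearning.Model) (hc : G.c = 0)
    (hunb : G.UnboundedPrivateBeliefs)
    (σ : G.Profile) (hσ : σ.IsEquilibrium) :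
    σ.ExpandingObservations :=
  hσ.1.expandingObservations hc hunb
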